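/- A set $S\subseteq\mathbb{Z}^d$ is called sum-free if there are no $a,b,c\in S$, not necessarily distinct, with $a+b=c$. For an integer $n\ge 0$ let $[n]^d=\{1,\dots,n\}^d\subset\mathbb{Z}^d$, and let $M([n]^d)$ denote the largest size of a sum-free subset of $[n]^d$. Then for every fixed integer $d\ge 0$ (the case $d=0$ being trivial), the number of sum-free subsets of $[n]^d$ is $$2^{M([n]^d)+o(n^d)}\qquad (n\to\infty),$$ where the $o(n^d)$ term may depend on $d$; that is, there is a function $e_d:\mathbb{N}\to\mathbb{R}$ with $e_d(n)/n^d\to 0$ as $n\to\infty$ such that the number of sum-free subsets of $[n]^d$ equals $2^{M([n]^d)+e_d(n)}$ for every $n$. -/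

import Mathlib

open Filter Asymptotics

/-- A subset `S` of an additive commutative group is sum-free if there is no solution of
`a + b = c` with `a, b, c ∈ S` (the elements `a`, `b`, `c` need not be distinct). -/
def IsSumFree {G : Type*} [AddCommGroup G] (S : Set G) : Prop :=
  ∀ a ∈ S, ∀ b ∈ S, ∀ c ∈ S, a + b ≠ c

/-- The lattice box `[n]^d = {1, …, n}^d` inside `ℤ^d`. -/
noncomputable def latticeBox (n d : ℕ) : Finset (Fin d → ℤ) :=
  Fintype.piFinset fun _ => Finset.Icc (1 : ℤ) (n : ℤ)

open Classical in
/-- The family of all sum-free subsets of a finite set `R`. -/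
noncomputable def sumFreeSubsets {G : Type*} [AddCommGroup G] (R : Finset G) :
    Finset (Finset G) :=
  R.powerset.filter fun S : Finset G => IsSumFree (S : Set G)

/-- The number of sum-free subsets of `R`. -/
noncomputable def numSumFree {G : Type*} [AddCommGroup G] (R : Finset G) : ℕ :=
  (sumFreeSubsets R).card

/-- The largest size of a sum-free subset of `R` (the empty set is one, so the maximum is over a
nonempty family). -/
noncomputable def maxSumFree {G : Type*} [AddCommGroup G] (R : Finset G) : ℕ :=
  (sumFreeSubsets R).sup Finset.card

/-!
Take disjoint Schur triples `a + b = c` greedily from a set `A` that exceeds `maxSumFree R` by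
`ε * #R` elements: linearly many are found. Their translates `(x, x + a, x + c)` by `x ∈ R` are
edge-disjoint triangles of a tripartite graph on copies of `R`, `R + A` and `R + A`, all of whose
triangles come from Schur triples of `A`. As `R + R` is not much larger than `R`, triangle removal
shows that `A` has quadratically many Schur triples.

Then linearly many `t ∈ A` are popular second summands. A sum-free `S ⊆ A` either contains few of
them, so that it is determined up to a few elements outside a much smaller set, or contains a large
constant number of them, say `T`. In the latter case `S` is independent in the directed graph with
edges `v → v + t` for `t ∈ T`, and Sapozhenko's graph containers apply. Either way `S` lies in one
of `2 ^ o(#R)` subsets of `A` that are smaller by a constant fraction of `#R`. After boundedly many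
iterations every container has at most `maxSumFree R + ε * #R` elements.
-/

open Finset
open scoped Pointwise

section SumFree

variable {G : Type*} [AddCommGroup G] {A R S : Finset G}

theorem mem_sumFreeSubsets : S ∈ sumFreeSubsets R ↔ S ⊆ R ∧ IsSumFree (S : Set G) := by
  simp [sumFreeSubsets]

theorem IsSumFree.mono {S T : Set G} (hT : IsSumFree T) (h : S ⊆ T) : IsSumFree S :=
  fun a ha b hb c hc => hT a (h ha) b (h hb) c (h hc)

theorem isSumFree_empty : IsSumFree (∅ : Set G) := fun _ ha => ha.elim

theorem IsSumFree.card_le_maxSumFree (hS : IsSumFree (S : Set G)) (hSR : S ⊆ R) :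
    #S ≤ maxSumFree R :=
  le_sup (f := card) (mem_sumFreeSubsets.2 ⟨hSR, hS⟩)

theorem numSumFree_le_two_pow_card (A : Finset G) : numSumFree A ≤ 2 ^ #A := by
  rw [← card_powerset]
  exact card_le_card fun S hS => mem_powerset.2 (mem_sumFreeSubsets.1 hS).1

theorem two_pow_maxSumFree_le_numSumFree (R : Finset G) : 2 ^ maxSumFree R ≤ numSumFree R := by
  obtain ⟨S, hS, hmax⟩ := exists_mem_eq_sup (sumFreeSubsets R)
    ⟨∅, mem_sumFreeSubsets.2 ⟨empty_subset R, by simpa using isSumFree_empty⟩⟩ card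
  obtain ⟨hSR, hSfree⟩ := mem_sumFreeSubsets.1 hS
  rw [maxSumFree, hmax, ← card_powerset]
  refine card_le_card fun T hT => ?_
  have hTS : T ⊆ S := mem_powerset.1 hT
  exact mem_sumFreeSubsets.2 ⟨hTS.trans hSR, hSfree.mono (coe_subset.2 hTS)⟩

theorem sumFreeSubsets_of_subsingleton [Subsingleton G] (R : Finset G) :
    sumFreeSubsets R = {∅} := by
  ext S
  rw [mem_sumFreeSubsets, mem_singleton]
  constructor
  · rintro ⟨-, hS⟩
    exact eq_empty_of_forall_notMem fun x hx => hS x hx x hx x hx (Subsingleton.elim _ _)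
  · rintro rfl
    exact ⟨empty_subset R, by simpa using isSumFree_empty⟩

/-- The error term `e` in `numSumFree R = 2 ^ (maxSumFree R + e)`. -/
noncomputable def sumFreeExcess (R : Finset G) : ℝ :=
  Real.logb 2 (numSumFree R) - maxSumFree R

theorem numSumFree_pos (R : Finset G) : 0 < numSumFree R :=
  (Nat.two_pow_pos _).trans_le (two_pow_maxSumFree_le_numSumFree R)

theorem numSumFree_eq_two_rpow_add_sumFreeExcess (R : Finset G) :
    (numSumFree R : ℝ) = 2 ^ ((maxSumFree R : ℝ) + sumFreeExcess R) := by
  rw [sumFreeExcess, add_sub_cancel,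
    Real.rpow_logb two_pos (by norm_num) (by exact_mod_cast numSumFree_pos R)]

theorem sumFreeExcess_nonneg (R : Finset G) : 0 ≤ sumFreeExcess R := by
  rw [sumFreeExcess, sub_nonneg,
    Real.le_logb_iff_rpow_le one_lt_two (by exact_mod_cast numSumFree_pos R), Real.rpow_natCast]
  exact_mod_cast two_pow_maxSumFree_le_numSumFree R

theorem sumFreeExcess_le_iff {x : ℝ} :
    sumFreeExcess R ≤ x ↔ (numSumFree R : ℝ) ≤ 2 ^ ((maxSumFree R : ℝ) + x) := by
  rw [sumFreeExcess, sub_le_iff_le_add',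
    Real.logb_le_iff_le_rpow one_lt_two (by exact_mod_cast numSumFree_pos R)]

end SumFree

section Supersaturation

open SimpleGraph TripartiteFromTriangles

variable {G : Type*} [AddCommGroup G] [DecidableEq G] {A R X : Finset G} {P : Finset (G × G)}

/-- The Schur triples `a + b = c` in `A`, encoded by the pairs `(a, b)`. -/
def schurPairs (A : Finset G) : Finset (G × G) :=
  {p ∈ A ×ˢ A | p.1 + p.2 ∈ A}

theorem mem_schurPairs {p : G × G} :
    p ∈ schurPairs A ↔ p.1 ∈ A ∧ p.2 ∈ A ∧ p.1 + p.2 ∈ A := by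
  simp [schurPairs, and_assoc]

/-- A family of Schur triples `a + b = c` in `A`, no two of which share their first summand, their
second summand, or their sum. -/
structure IsSchurMatching (A : Finset G) (P : Finset (G × G)) : Prop where
  subset_schurPairs : P ⊆ schurPairs A
  injOn_fst : Set.InjOn Prod.fst (P : Set (G × G))
  injOn_snd : Set.InjOn Prod.snd (P : Set (G × G))
  injOn_add : Set.InjOn (fun p => p.1 + p.2) (P : Set (G × G))

/-- The elements occurring in the Schur triples encoded by `P`, as a summand or as the sum. -/
def schurSupport (P : Finset (G × G)) : Finset G :=
  P.image Prod.fst ∪ P.image Prod.snd ∪ P.image fun p => p.1 + p.2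

theorem card_schurSupport_le (P : Finset (G × G)) : #(schurSupport P) ≤ 3 * #P := by
  calc #(schurSupport P) ≤ #P + #P + #P :=
        (card_union_le _ _).trans (add_le_add ((card_union_le _ _).trans
          (add_le_add card_image_le card_image_le)) card_image_le)
    _ = 3 * #P := by ring

theorem IsSchurMatching.insert (hP : IsSchurMatching A P) {a b : G} (ha : a ∈ A \ schurSupport P)
    (hb : b ∈ A \ schurSupport P) (hab : a + b ∈ A \ schurSupport P) :
    IsSchurMatching A (insert (a, b) P) := by
  simp only [Finset.mem_sdiff, schurSupport, mem_union, mem_image, not_or] at ha hb hab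
  have hnotMem : (a, b) ∉ (P : Set (G × G)) := fun h => ha.2.1.1 ⟨_, h, rfl⟩
  refine ⟨insert_subset (mem_schurPairs.2 ⟨ha.1, hb.1, hab.1⟩) hP.subset_schurPairs, ?_, ?_, ?_⟩
  all_goals rw [coe_insert, Set.injOn_insert hnotMem]
  · exact ⟨hP.injOn_fst, ha.2.1.1⟩
  · exact ⟨hP.injOn_snd, hb.2.1.2⟩
  · exact ⟨hP.injOn_add, hab.2.2⟩

theorem exists_isSchurMatching_card_le (hAR : A ⊆ R) :
    ∃ P, IsSchurMatching A P ∧ #A ≤ maxSumFree R + 3 * #P := by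
  classical
  obtain ⟨P, hP, hmax⟩ := ({P ∈ (schurPairs A).powerset | IsSchurMatching A P}).exists_max_image
    card ⟨∅, by simpa using IsSchurMatching.mk (empty_subset _) (by simp) (by simp) (by simp)⟩
  replace hP : IsSchurMatching A P := (mem_filter.1 hP).2
  refine ⟨P, hP, ?_⟩
  have hfree : IsSumFree ((A \ schurSupport P : Finset G) : Set G) := by
    rintro a ha b hb _ hab rfl
    have hins : IsSchurMatching A (insert (a, b) P) := hP.insert ha hb hab
    have hnotMem : (a, b) ∉ P := fun h =>
      (Finset.mem_sdiff.1 ha).2 (by simpa [schurSupport] using .inl ⟨b, h⟩)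
    have hle := hmax _ (mem_filter.2 ⟨mem_powerset.2 hins.subset_schurPairs, hins⟩)
    rw [card_insert_of_notMem hnotMem] at hle
    omega
  have hmaximal := hfree.card_le_maxSumFree (sdiff_subset.trans hAR)
  have hsdiff := le_card_sdiff (schurSupport P) A
  have hsupport := card_schurSupport_le P
  omega

/-- The translates `(x, x + a, x + a + b)` with `x ∈ X` and `(a, b) ∈ P`. They index triangles in a
tripartite graph on `X`, `X + A` and `X + A`. -/
def schurTriangles (X A : Finset G) (P : Finset (G × G)) : Finset (X × ↥(X + A) × ↥(X + A)) :=
  {w | ((w.2.1 - w.1 : G), (w.2.2 - w.2.1 : G)) ∈ P}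

theorem mem_schurTriangles {x : X} {y z : ↥(X + A)} :
    (x, y, z) ∈ schurTriangles X A P ↔ ((y - x : G), (z - y : G)) ∈ P := by
  simp [schurTriangles]

theorem card_schurTriangles (hP : P ⊆ schurPairs A) : #(schurTriangles X A P) = #X * #P := by
  rw [← card_product]
  refine card_nbij (fun w => ((w.1 : G), (w.2.1 - w.1 : G), (w.2.2 - w.2.1 : G))) ?_ ?_ ?_
  · rintro ⟨x, y, z⟩ h
    exact mem_product.2 ⟨x.2, mem_schurTriangles.1 h⟩
  · rintro ⟨x, y, z⟩ - ⟨x', y', z'⟩ - h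
    simp only [Prod.mk.injEq] at h
    obtain ⟨hx, hy, hz⟩ := h
    obtain rfl := Subtype.ext hx
    obtain rfl := Subtype.ext (sub_left_injective hy)
    obtain rfl := Subtype.ext (sub_left_injective hz)
    rfl
  · rintro ⟨x, a, b⟩ h
    obtain ⟨hx, hab⟩ := mem_product.1 h
    obtain ⟨ha, -, hsum⟩ := mem_schurPairs.1 (hP hab)
    exact ⟨(⟨x, hx⟩, ⟨x + a, add_mem_add hx ha⟩, ⟨x + (a + b), add_mem_add hx hsum⟩),
      by simpa [mem_schurTriangles] using hab, by simp⟩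

theorem IsSchurMatching.explicitDisjoint_schurTriangles (hP : IsSchurMatching A P) :
    ExplicitDisjoint (schurTriangles X A P) where
  inj₀ x y z x' h h' := by
    have heq := hP.injOn_snd (mem_schurTriangles.1 h) (mem_schurTriangles.1 h') rfl
    exact Subtype.ext (by simpa using congrArg Prod.fst heq)
  inj₁ x y z y' h h' := by
    have heq := hP.injOn_add (mem_schurTriangles.1 h) (mem_schurTriangles.1 h') (by simp)
    exact Subtype.ext (by simpa using congrArg Prod.fst heq)
  inj₂ x y z z' h h' := by
    have heq := hP.injOn_fst (mem_schurTriangles.1 h) (mem_schurTriangles.1 h') rfl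
    exact Subtype.ext (by simpa using congrArg Prod.snd heq)

/- Every triangle of the graph, accidental or not, is a translated Schur triple of `A`. -/
theorem card_cliqueFinset_graph_schurTriangles_le (hP : P ⊆ schurPairs A) :
    #((graph (schurTriangles X A P)).cliqueFinset 3) ≤ #X * #(schurPairs A) := by
  rw [← card_schurTriangles (X := X) (Subset.refl (schurPairs A))]
  refine card_le_card_of_surjOn toTriangle fun s hs => ?_
  rw [mem_coe, mem_cliqueFinset_iff, is3Clique_iff] at hs
  obtain ⟨u, v, w, huv, huw, hvw, rfl⟩ := hs
  obtain ⟨x, y, z, hxyz, hxy, hxz, hyz⟩ := graph_triple huv huw hvw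
  obtain ⟨z', hz'⟩ := Graph.in₀₁_iff.1 hxy
  obtain ⟨y', hy'⟩ := Graph.in₀₂_iff.1 hxz
  obtain ⟨x', hx'⟩ := Graph.in₁₂_iff.1 hyz
  have hfst : (y - x : G) ∈ A := (mem_schurPairs.1 (hP (mem_schurTriangles.1 hz'))).1
  have hsnd : (z - y : G) ∈ A := (mem_schurPairs.1 (hP (mem_schurTriangles.1 hx'))).2.1
  have hadd : (z - x : G) ∈ A := by
    simpa using (mem_schurPairs.1 (hP (mem_schurTriangles.1 hy'))).2.2
  exact ⟨(x, y, z), mem_schurTriangles.2 (mem_schurPairs.2 ⟨hfst, hsnd, by simpa using hadd⟩),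
    hxyz⟩

theorem IsSchurMatching.triangleRemovalBound_mul_le_card_schurPairs (hP : IsSchurMatching A P)
    {η : ℝ} (hη : η * (#X + 2 * #(X + A) : ℝ) ^ 2 ≤ #X * #P) :
    triangleRemovalBound η * (#X + 2 * #(X + A) : ℝ) ^ 3 ≤ #X * #(schurPairs A) := by
  have := hP.explicitDisjoint_schurTriangles (X := X)
  have hfar : (graph (schurTriangles X A P)).FarFromTriangleFree η := by
    refine farFromTriangleFree _ ?_
    rw [card_schurTriangles hP.subset_schurPairs]
    simp only [Fintype.card_coe]
    push_cast
    linarith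
  have hmany := hfar.le_card_cliqueFinset
  simp only [Fintype.card_sum, Fintype.card_coe] at hmany
  push_cast at hmany
  calc (triangleRemovalBound η * (#X + 2 * #(X + A) : ℝ) ^ 3 : ℝ)
      = triangleRemovalBound η * (#X + (#(X + A) + #(X + A)) : ℝ) ^ 3 := by ring
    _ ≤ (#((graph (schurTriangles X A P)).cliqueFinset 3) : ℝ) := hmany
    _ ≤ (#X * #(schurPairs A) : ℝ) := by
        exact_mod_cast card_cliqueFinset_graph_schurTriangles_le hP.subset_schurPairs

end Supersaturation

theorem exists_mul_card_sq_le_card_schurPairs {K ε : ℝ} (hK : 0 ≤ K) (hε : 0 < ε) :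
    ∃ δ > 0, ∀ ⦃G : Type*⦄ [AddCommGroup G] [DecidableEq G] ⦃A R : Finset G⦄, A ⊆ R →
      (#(R + R) : ℝ) ≤ K * #R → maxSumFree R + ε * #R ≤ #A →
      δ * (#R : ℝ) ^ 2 ≤ #(schurPairs A) := by
  set η : ℝ := ε / (3 * (1 + 2 * K) ^ 2) with hη
  have hbound : 0 < SimpleGraph.triangleRemovalBound η :=
    SimpleGraph.triangleRemovalBound_pos (by positivity)
  refine ⟨_, hbound, fun G _ _ A R hAR hdoubling hA => ?_⟩
  obtain rfl | hR := R.eq_empty_or_nonempty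
  · simp
  have hRpos : (0 : ℝ) < #R := by exact_mod_cast hR.card_pos
  obtain ⟨P, hP, hcard⟩ := exists_isSchurMatching_card_le hAR
  have hPε : ε * #R ≤ 3 * #P := by
    have : (#A : ℝ) ≤ maxSumFree R + 3 * #P := by exact_mod_cast hcard
    linarith
  have hsumset : (#(R + A) : ℝ) ≤ K * #R :=
    le_trans (by exact_mod_cast card_le_card (add_subset_add_left hAR)) hdoubling
  have hfew : η * (#R + 2 * #(R + A) : ℝ) ^ 2 ≤ #R * #P :=
    calc η * (#R + 2 * #(R + A) : ℝ) ^ 2 ≤ η * (#R + 2 * (K * #R)) ^ 2 := by gcongr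
      _ = #R * (ε * #R / 3) := by rw [hη]; field_simp
      _ ≤ #R * #P := by gcongr; linarith
  refine le_of_mul_le_mul_left ?_ hRpos
  calc #R * (SimpleGraph.triangleRemovalBound η * (#R : ℝ) ^ 2)
      = SimpleGraph.triangleRemovalBound η * (#R : ℝ) ^ 3 := by ring
    _ ≤ SimpleGraph.triangleRemovalBound η * (#R + 2 * #(R + A) : ℝ) ^ 3 := by
        gcongr
        exact le_add_of_nonneg_right (by positivity)
    _ ≤ #R * #(schurPairs A) := hP.triangleRemovalBound_mul_le_card_schurPairs hfew

section GraphContainer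

variable {α : Type*} {r : α → α → Prop} [DecidableRel r] {A F S : Finset α} {v : α} {γ : ℝ}

/-- The out-neighbourhood of `F` in the directed graph that `r` induces on `A`. -/
def outNeighbors (r : α → α → Prop) [DecidableRel r] (A F : Finset α) : Finset α :=
  {w ∈ A | ∃ v ∈ F, r v w}

theorem outNeighbors_subset : outNeighbors r A F ⊆ A := filter_subset _ _

variable [DecidableEq α]

/-- Sapozhenko's container with fingerprint `F` in the directed graph that `r` induces on `A`: once
the out-neighbours of `F` are removed, keep the vertices with fewer than `γ` out-neighbours left. -/
noncomputable def graphContainer (r : α → α → Prop) [DecidableRel r] (A : Finset α) (γ : ℝ)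
    (F : Finset α) : Finset α :=
  {v ∈ A \ outNeighbors r A F | (#((A \ outNeighbors r A F).bipartiteAbove r v) : ℝ) < γ}

theorem graphContainer_subset : graphContainer r A γ F ⊆ A :=
  (filter_subset _ _).trans sdiff_subset

theorem card_outNeighbors_insert : #(outNeighbors r A (insert v F)) =
    #(outNeighbors r A F) + #((A \ outNeighbors r A F).bipartiteAbove r v) := by
  rw [← card_union_of_disjoint]
  · congr 1
    ext w
    simp only [outNeighbors, bipartiteAbove, mem_filter, mem_union, Finset.mem_sdiff,
      exists_mem_insert]
    grind
  · exact disjoint_sdiff.mono_right (filter_subset _ _)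

/- The fingerprint is a largest `F ⊆ S` whose elements have at least `γ` out-neighbours each on
average: a vertex of `S` with `γ` out-neighbours outside those of `F` could be added to it. -/
theorem exists_subset_graphContainer (hSA : S ⊆ A) (hS : ∀ v ∈ S, ∀ w ∈ S, ¬ r v w)
    (hγ : 0 < γ) : ∃ F ⊆ S, γ * #F ≤ #A ∧ S ⊆ graphContainer r A γ F := by
  obtain ⟨F, hF, hmax⟩ := ({F ∈ S.powerset | γ * #F ≤ #(outNeighbors r A F)}).exists_max_image
    card ⟨∅, by simp⟩
  simp only [mem_filter, mem_powerset] at hF hmax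
  obtain ⟨hFS, hFcard⟩ := hF
  refine ⟨F, hFS, hFcard.trans (by exact_mod_cast card_le_card outNeighbors_subset), fun v hv => ?_⟩
  refine mem_filter.2 ⟨Finset.mem_sdiff.2 ⟨hSA hv, fun hvF => ?_⟩, ?_⟩
  · obtain ⟨-, f, hf, hfv⟩ := mem_filter.1 hvF
    exact hS f (hFS hf) v hv hfv
  by_contra! hγle
  have hcard := card_outNeighbors_insert (r := r) (A := A) (F := F) (v := v)
  have hvF : v ∉ F := fun h => by
    rw [insert_eq_of_mem h, left_eq_add] at hcard
    rw [hcard, Nat.cast_zero] at hγle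
    exact hγ.not_ge hγle
  have hle := hmax (insert v F) ⟨insert_subset hv hFS, by
    rw [hcard, card_insert_of_notMem hvF]
    push_cast
    linarith⟩
  rw [card_insert_of_notMem hvF] at hle
  omega

theorem card_bipartiteAbove_eq_add {N : Finset α} (hN : N ⊆ A) :
    #(A.bipartiteAbove r v) = #(N.bipartiteAbove r v) + #((A \ N).bipartiteAbove r v) := by
  have hunion : A.bipartiteAbove r v = N.bipartiteAbove r v ∪ (A \ N).bipartiteAbove r v := by
    rw [bipartiteAbove, bipartiteAbove, bipartiteAbove, ← filter_union, union_sdiff_of_subset hN]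
  rw [hunion]
  exact card_union_of_disjoint (disjoint_filter_filter disjoint_sdiff)

theorem sum_card_bipartiteAbove_le {Δ : ℕ} (hout : ∀ v ∈ A, #(A.bipartiteAbove r v) ≤ Δ)
    (hin : ∀ w ∈ A, #(A.bipartiteBelow r w) ≤ Δ) (hγ : 0 ≤ γ) :
    (∑ v ∈ A, #(A.bipartiteAbove r v) : ℝ) ≤ 2 * Δ * #(A \ graphContainer r A γ F) + γ * #A := by
  set N := outNeighbors r A F
  set C := graphContainer r A γ F
  have hCA : C ⊆ A := graphContainer_subset
  have hNsub : N ⊆ A \ C := fun w hw => Finset.mem_sdiff.2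
    ⟨outNeighbors_subset hw, fun h => (Finset.mem_sdiff.1 (mem_filter.1 h).1).2 hw⟩
  have hleave : ∑ v ∈ A \ C, #(A.bipartiteAbove r v) ≤ #(A \ C) * Δ :=
    sum_le_card_nsmul _ _ _ fun v hv => hout v (sdiff_subset hv)
  have hinto : ∑ v ∈ C, #(N.bipartiteAbove r v) ≤ #(A \ C) * Δ :=
    calc ∑ v ∈ C, #(N.bipartiteAbove r v) = ∑ w ∈ N, #(C.bipartiteBelow r w) :=
          sum_card_bipartiteAbove_eq_sum_card_bipartiteBelow r
      _ ≤ #N * Δ := sum_le_card_nsmul _ _ _ fun w hw =>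
          (card_le_card (filter_subset_filter _ hCA)).trans (hin w (outNeighbors_subset hw))
      _ ≤ #(A \ C) * Δ := by gcongr
  have hremain : (∑ v ∈ C, #((A \ N).bipartiteAbove r v) : ℝ) ≤ γ * #A :=
    calc (∑ v ∈ C, #((A \ N).bipartiteAbove r v) : ℝ) ≤ #C • γ :=
          sum_le_card_nsmul _ _ _ fun v hv => (mem_filter.1 hv).2.le
      _ ≤ γ * #A := by rw [nsmul_eq_mul, mul_comm]; gcongr
  have htotal : ∑ v ∈ A, #(A.bipartiteAbove r v) = ∑ v ∈ A \ C, #(A.bipartiteAbove r v) +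
      (∑ v ∈ C, #(N.bipartiteAbove r v) + ∑ v ∈ C, #((A \ N).bipartiteAbove r v)) := by
    rw [← sum_sdiff hCA, ← sum_add_distrib, add_right_inj]
    exact sum_congr rfl fun v _ => card_bipartiteAbove_eq_add outNeighbors_subset
  have hleave' : (∑ v ∈ A \ C, #(A.bipartiteAbove r v) : ℝ) ≤ #(A \ C) * Δ := by
    exact_mod_cast hleave
  have hinto' : (∑ v ∈ C, #(N.bipartiteAbove r v) : ℝ) ≤ #(A \ C) * Δ := by exact_mod_cast hinto
  have htotal' := congrArg (Nat.cast : ℕ → ℝ) htotal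
  push_cast at htotal'
  linarith

end GraphContainer

section SmallSubsets

/-- The subsets of `A` with at most `s` elements. -/
noncomputable def smallSubsets {α : Type*} (A : Finset α) (s : ℝ) : Finset (Finset α) :=
  {S ∈ A.powerset | (#S : ℝ) ≤ s}

theorem mem_smallSubsets {α : Type*} {A S : Finset α} {s : ℝ} :
    S ∈ smallSubsets A s ↔ S ⊆ A ∧ (#S : ℝ) ≤ s := by
  simp [smallSubsets]

theorem card_smallSubsets_mul_rpow_le {α : Type*} (A : Finset α) (s : ℝ) {x : ℝ} (hx₀ : 0 < x)
    (hx₁ : x ≤ 1) : #(smallSubsets A s) * x ^ s ≤ (x + 1) ^ #A :=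
  calc #(smallSubsets A s) * x ^ s = ∑ _S ∈ smallSubsets A s, x ^ s := by
        rw [sum_const, nsmul_eq_mul]
    _ ≤ ∑ S ∈ smallSubsets A s, x ^ #S := sum_le_sum fun S hS => by
        rw [← Real.rpow_natCast]
        exact Real.rpow_le_rpow_of_exponent_ge hx₀ hx₁ (mem_smallSubsets.1 hS).2
    _ ≤ ∑ S ∈ A.powerset, x ^ #S :=
        sum_le_sum_of_subset_of_nonneg (filter_subset _ _) fun _ _ _ => by positivity
    _ = (x + 1) ^ #A := by simpa using sum_pow_mul_eq_add_pow x 1 A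

theorem exists_card_smallSubsets_le {κ : ℝ} (hκ : 0 < κ) :
    ∃ θ > 0, ∀ ⦃α : Type*⦄ (A : Finset α) (N : ℝ), #A ≤ N →
      (#(smallSubsets A (θ * N)) : ℝ) ≤ 2 ^ (κ * N) := by
  obtain ⟨a, ha⟩ : ∃ a : ℕ, (2⁻¹ : ℝ) ^ a < 2 ^ (κ / 2) - 1 :=
    exists_pow_lt_of_lt_one (sub_pos.2 (Real.one_lt_rpow one_lt_two (half_pos hκ))) (by norm_num)
  set x : ℝ := 2⁻¹ ^ a with hx
  have hxpos : 0 < x := by positivity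
  set θ : ℝ := κ / (2 * (a + 1)) with hθ
  have haθ : a * θ ≤ κ / 2 := by
    rw [hθ, mul_div_assoc', div_le_div_iff₀ (by positivity) two_pos]
    linarith
  refine ⟨θ, by positivity, fun α A N hA => ?_⟩
  have hN : 0 ≤ N := (Nat.cast_nonneg _).trans hA
  have hpow : (x + 1) ^ #A ≤ (2 : ℝ) ^ (κ / 2 * N) :=
    calc (x + 1) ^ #A ≤ ((2 : ℝ) ^ (κ / 2)) ^ #A := by gcongr; linarith
      _ = 2 ^ (κ / 2 * #A) := by rw [← Real.rpow_mul_natCast two_pos.le]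
      _ ≤ 2 ^ (κ / 2 * N) := by gcongr; exact one_le_two
  have hxrpow : x ^ (θ * N) = ((2 : ℝ) ^ (a * θ * N))⁻¹ := by
    rw [hx, ← Real.rpow_natCast_mul (by norm_num), Real.inv_rpow two_pos.le, mul_assoc]
  have hbound := card_smallSubsets_mul_rpow_le A (θ * N) hxpos
    (pow_le_one₀ (by norm_num) (by norm_num))
  rw [hxrpow, ← div_eq_mul_inv, div_le_iff₀ (by positivity)] at hbound
  calc (#(smallSubsets A (θ * N)) : ℝ) ≤ (x + 1) ^ #A * 2 ^ (a * θ * N) := hbound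
    _ ≤ 2 ^ (κ / 2 * N) * 2 ^ (κ / 2 * N) := by
        gcongr
        exact one_le_two
    _ = 2 ^ (κ * N) := by rw [← Real.rpow_add two_pos]; ring_nf

end SmallSubsets

section SchurContainer

variable {G : Type*} [AddCommGroup G] [DecidableEq G] {A F S T : Finset G} {m γ : ℝ} {q : ℕ}

theorem card_bipartiteAbove_sub_mem (A T : Finset G) (v : G) :
    #(A.bipartiteAbove (fun v w => w - v ∈ T) v) =
      #(T.bipartiteAbove (fun v t => v + t ∈ A) v) :=
  card_nbij' (· - v) (v + ·) (fun w => by simp +contextual) (fun t => by simp +contextual)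
    (fun w => by simp) fun t => by simp

theorem card_bipartiteBelow_sub_mem_le (A T : Finset G) (w : G) :
    #(A.bipartiteBelow (fun v w => w - v ∈ T) w) ≤ #T :=
  card_le_card_of_injOn (w - ·) (fun v => by simp) sub_right_injective.injOn

/-- The elements `t` of `A` that are the second summand of at least `m` Schur triples `v + t = w`
in `A`. -/
noncomputable def popularSummands (A : Finset G) (m : ℝ) : Finset G :=
  {t ∈ A | m ≤ #{v ∈ A | v + t ∈ A}}

theorem popularSummands_subset : popularSummands A m ⊆ A := filter_subset _ _

theorem card_schurPairs_le (A : Finset G) (hm : 0 ≤ m) :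
    (#(schurPairs A) : ℝ) ≤ #(popularSummands A m) * #A + #A * m := by
  have hfiber : #(schurPairs A) = ∑ t ∈ A, #{v ∈ A | v + t ∈ A} := by
    rw [schurPairs, card_filter, sum_product_right]
    simp only [card_filter]
  rw [hfiber, Nat.cast_sum, ← sum_filter_add_sum_filter_not A (· ∈ popularSummands A m),
    filter_mem_eq_inter, inter_eq_right.2 popularSummands_subset]
  refine add_le_add ?_ ?_
  · rw [← nsmul_eq_mul]
    exact sum_le_card_nsmul _ _ _ fun t _ => by exact_mod_cast card_filter_le _ _
  · refine (sum_le_card_nsmul _ _ m fun t ht => ?_).trans ?_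
    · obtain ⟨htA, htm⟩ := mem_filter.1 ht
      exact (not_le.1 fun h => htm (mem_filter.2 ⟨htA, h⟩)).le
    · rw [nsmul_eq_mul]
      gcongr
      exact filter_subset _ _

theorem half_mul_le_card_popularSummands {N δ : ℝ} (hN : 0 < N) (hδ : 0 ≤ δ) (hA : #A ≤ N)
    (hmany : δ * N ^ 2 ≤ #(schurPairs A)) : δ / 2 * N ≤ #(popularSummands A (δ / 2 * N)) := by
  have hpairs := card_schurPairs_le A (m := δ / 2 * N) (by positivity)
  refine le_of_mul_le_mul_right ?_ hN
  calc δ / 2 * N * N = δ * N ^ 2 - N * (δ / 2 * N) := by ring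
    _ ≤ δ * N ^ 2 - #A * (δ / 2 * N) := by gcongr
    _ ≤ #(popularSummands A (δ / 2 * N)) * #A := by linarith
    _ ≤ #(popularSummands A (δ / 2 * N)) * N := by gcongr

theorem card_mul_le_of_subset_popularSummands (hT : T ⊆ popularSummands A m) (hγ : 0 ≤ γ) :
    #T * m ≤ 2 * #T * #(A \ graphContainer (fun v w => w - v ∈ T) A γ F) + γ * #A := by
  calc #T * m = #T • m := (nsmul_eq_mul _ _).symm
    _ ≤ ∑ t ∈ T, (#(A.bipartiteBelow (fun v t => v + t ∈ A) t) : ℝ) :=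
        card_nsmul_le_sum _ _ _ fun t ht => (mem_filter.1 (hT ht)).2
    _ = ∑ v ∈ A, (#(A.bipartiteAbove (fun v w => w - v ∈ T) v) : ℝ) := by
        simp only [card_bipartiteAbove_sub_mem]
        exact_mod_cast (sum_card_bipartiteAbove_eq_sum_card_bipartiteBelow _).symm
    _ ≤ 2 * #T * #(A \ graphContainer (fun v w => w - v ∈ T) A γ F) + γ * #A :=
        sum_card_bipartiteAbove_le
          (fun v _ => (card_bipartiteAbove_sub_mem A T v).trans_le (card_filter_le _ _))
          (fun w _ => card_bipartiteBelow_sub_mem_le A T w) hγ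

/-- The container for sum-free subsets of `A` with fingerprints `T` and `F`. If `T` has fewer than
`q` elements it stands for all the popular summands of the sum-free set; otherwise the sum-free set
is independent in the directed graph with edges `v → v + t` for `t ∈ T`, and `F` is its fingerprint
there. -/
noncomputable def schurContainer (A : Finset G) (m γ : ℝ) (q : ℕ) (T F : Finset G) : Finset G :=
  if #T < q then (A \ popularSummands A m) ∪ T
  else graphContainer (fun v w => w - v ∈ T) A γ F

theorem schurContainer_subset (hT : T ⊆ A) : schurContainer A m γ q T F ⊆ A := by
  rw [schurContainer]
  split_ifs
  · exact union_subset sdiff_subset hT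
  · exact graphContainer_subset

theorem IsSumFree.exists_subset_schurContainer (hS : IsSumFree (S : Set G)) (hSA : S ⊆ A)
    (hγ : 0 < γ) : ∃ T ⊆ popularSummands A m, #T ≤ q ∧
      ∃ F ⊆ A, γ * #F ≤ #A ∧ S ⊆ schurContainer A m γ q T F := by
  obtain hlt | hle := lt_or_ge #(S ∩ popularSummands A m) q
  · refine ⟨S ∩ popularSummands A m, inter_subset_right, hlt.le, ∅, empty_subset A, by simp, ?_⟩
    rw [schurContainer, if_pos hlt]
    intro x hx
    by_cases hxD : x ∈ popularSummands A m <;> simp [hx, hxD, hSA hx]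
  · obtain ⟨T, hT, hTq⟩ := exists_subset_card_eq hle
    obtain ⟨hTS, hTD⟩ := subset_inter_iff.1 hT
    obtain ⟨F, hFS, hF, hSF⟩ := exists_subset_graphContainer (r := fun v w => w - v ∈ T) hSA
      (fun v hv w hw h => hS v hv _ (hTS h) w hw (add_sub_cancel v w)) hγ
    exact ⟨T, hTD, hTq.le, F, hFS.trans hSA, hF, by rwa [schurContainer, if_neg hTq.not_lt]⟩

theorem card_schurContainer_le {N δ : ℝ} (hN : 0 < N) (hδ : 0 < δ) (hA : #A ≤ N)
    (hmany : δ * N ^ 2 ≤ #(schurPairs A)) (hq : 0 < q) (hqN : q ≤ 3 / 8 * δ * N)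
    (hT : T ⊆ popularSummands A (δ / 2 * N)) (hTq : #T ≤ q) :
    (#(schurContainer A (δ / 2 * N) (δ * q / 4) q T F) : ℝ) ≤ #A - δ / 8 * N := by
  have hTA : T ⊆ A := hT.trans popularSummands_subset
  rw [le_sub_comm, ← cast_card_sdiff (schurContainer_subset hTA), schurContainer]
  split_ifs with hlt
  · have hpopular := half_mul_le_card_popularSummands hN hδ.le hA hmany
    have hltq : (#T : ℝ) < q := by exact_mod_cast hlt
    rw [← sup_eq_union, ← sdiff_sdiff_left, Finset.sdiff_sdiff_eq_self popularSummands_subset,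
      cast_card_sdiff hT]
    linarith
  · obtain rfl : #T = q := hTq.antisymm (not_lt.1 hlt)
    have hcount := card_mul_le_of_subset_popularSummands (F := F) hT
      (γ := δ * #T / 4) (by positivity)
    have hTpos : (0 : ℝ) < #T := by exact_mod_cast hq
    have : δ * #T / 4 * #A ≤ δ * #T / 4 * N := by gcongr
    refine le_of_mul_le_mul_left ?_ hTpos
    linarith

end SchurContainer

section SumFreeCover

variable {G : Type*} [AddCommGroup G] {A R : Finset G} {𝒞 : Finset (Finset G)}

/-- A family of containers for the sum-free subsets of `A`: subsets of `A` with at most `M`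
elements such that each sum-free subset of `A` lies in one of them. -/
structure IsSumFreeCover (𝒞 : Finset (Finset G)) (A : Finset G) (M : ℝ) : Prop where
  subset : ∀ B ∈ 𝒞, B ⊆ A
  card_le : ∀ B ∈ 𝒞, (#B : ℝ) ≤ M
  exists_subset : ∀ S ⊆ A, IsSumFree (S : Set G) → ∃ B ∈ 𝒞, S ⊆ B

theorem IsSumFreeCover.numSumFree_le_mul {M x : ℝ} (h𝒞 : IsSumFreeCover 𝒞 A M)
    (hx : ∀ B ∈ 𝒞, (numSumFree B : ℝ) ≤ x) : (numSumFree A : ℝ) ≤ #𝒞 * x := by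
  classical
  have hcover : sumFreeSubsets A ⊆ 𝒞.biUnion sumFreeSubsets := fun S hS => by
    obtain ⟨hSA, hfree⟩ := mem_sumFreeSubsets.1 hS
    obtain ⟨B, hB, hSB⟩ := h𝒞.exists_subset S hSA hfree
    exact mem_biUnion.2 ⟨B, hB, mem_sumFreeSubsets.2 ⟨hSB, hfree⟩⟩
  calc (numSumFree A : ℝ) ≤ ∑ B ∈ 𝒞, (numSumFree B : ℝ) := by
        exact_mod_cast (card_le_card hcover).trans card_biUnion_le
    _ ≤ #𝒞 * x := by
        rw [← nsmul_eq_mul]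
        exact sum_le_card_nsmul _ _ _ hx

theorem exists_isSumFreeCover_card_le [DecidableEq G] {N δ s : ℝ} {q : ℕ} (hN : 0 < N) (hδ : 0 < δ)
    (hA : #A ≤ N) (hmany : δ * N ^ 2 ≤ #(schurPairs A)) (hq : 0 < q) (hqs : q ≤ s)
    (hqN : q ≤ 3 / 8 * δ * N) (hsN : 4 * N ≤ δ * q * s) :
    ∃ 𝒞, #𝒞 ≤ #(smallSubsets (popularSummands A (δ / 2 * N)) s) * #(smallSubsets A s) ∧
      IsSumFreeCover 𝒞 A (#A - δ / 8 * N) := by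
  set D := popularSummands A (δ / 2 * N)
  have hmono : smallSubsets D q ⊆ smallSubsets D s := fun T hT =>
    mem_smallSubsets.2 ((mem_smallSubsets.1 hT).imp_right hqs.trans')
  refine ⟨image₂ (schurContainer A (δ / 2 * N) (δ * q / 4) q) (smallSubsets D q)
    (smallSubsets A s), (card_image₂_le _ _ _).trans (by gcongr), ?_, ?_, ?_⟩
  · refine forall_mem_image₂.2 fun T hT F _ => ?_
    exact schurContainer_subset ((mem_smallSubsets.1 hT).1.trans popularSummands_subset)
  · refine forall_mem_image₂.2 fun T hT F _ => ?_
    obtain ⟨hTD, hTq⟩ := mem_smallSubsets.1 hT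
    exact card_schurContainer_le hN hδ hA hmany hq hqN hTD (by exact_mod_cast hTq)
  · intro S hSA hS
    have hγ : 0 < δ * q / 4 := by positivity
    obtain ⟨T, hTD, hTq, F, hFA, hF, hSTF⟩ :=
      hS.exists_subset_schurContainer (m := δ / 2 * N) (q := q) hSA hγ
    have hFs : (#F : ℝ) ≤ s := le_of_mul_le_mul_left (by linarith) hγ
    exact ⟨_, mem_image₂_of_mem (mem_smallSubsets.2 ⟨hTD, by exact_mod_cast hTq⟩)
      (mem_smallSubsets.2 ⟨hFA, hFs⟩), hSTF⟩

theorem numSumFree_le_two_rpow_of_isSumFreeCover {L c η : ℝ} (hc : 0 ≤ c)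
    (hcover : ∀ A ⊆ R, L ≤ #A → ∃ 𝒞, (#𝒞 : ℝ) ≤ 2 ^ c ∧ IsSumFreeCover 𝒞 A (#A - η)) (k : ℕ)
    (hAR : A ⊆ R) (hA : #A ≤ L + k * η) : (numSumFree A : ℝ) ≤ 2 ^ (L + k * c) := by
  have hsmall {B : Finset G} (hB : (#B : ℝ) ≤ L) (k : ℕ) :
      (numSumFree B : ℝ) ≤ 2 ^ (L + k * c) :=
    calc (numSumFree B : ℝ) ≤ 2 ^ (#B : ℝ) := by
          rw [Real.rpow_natCast]
          exact_mod_cast numSumFree_le_two_pow_card B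
      _ ≤ 2 ^ (L + k * c) :=
          Real.rpow_le_rpow_of_exponent_le one_le_two (le_add_of_le_of_nonneg hB (by positivity))
  induction k generalizing A with
  | zero => exact hsmall (by simpa using hA) 0
  | succ k ih =>
    obtain hlt | hle := lt_or_ge (#A : ℝ) L
    · exact hsmall hlt.le _
    obtain ⟨𝒞, hcard, h𝒞⟩ := hcover A hAR hle
    push_cast at hA ⊢
    calc (numSumFree A : ℝ) ≤ #𝒞 * 2 ^ (L + k * c) :=
          h𝒞.numSumFree_le_mul fun B hB =>
            ih ((h𝒞.subset B hB).trans hAR) ((h𝒞.card_le B hB).trans (by linarith))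
      _ ≤ 2 ^ c * 2 ^ (L + k * c) := by gcongr
      _ = 2 ^ (L + (k + 1) * c) := by rw [← Real.rpow_add two_pos]; ring_nf

end SumFreeCover

theorem exists_forall_isSumFreeCover_card_le_two_rpow {δ κ : ℝ} (hδ : 0 < δ) (hκ : 0 < κ) :
    ∃ N₀ : ℝ, ∀ ⦃G : Type*⦄ [AddCommGroup G] [DecidableEq G] ⦃A : Finset G⦄ ⦃N : ℝ⦄, N₀ ≤ N →
      #A ≤ N → δ * N ^ 2 ≤ #(schurPairs A) →
      ∃ 𝒞, (#𝒞 : ℝ) ≤ 2 ^ (κ * N) ∧ IsSumFreeCover 𝒞 A (#A - δ / 8 * N) := by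
  obtain ⟨θ, hθ, hfew⟩ := exists_card_smallSubsets_le (half_pos hκ)
  obtain ⟨q, hq⟩ := exists_nat_gt (4 / (δ * θ))
  have hqpos : (0 : ℝ) < q := hq.trans' (by positivity)
  rw [div_lt_iff₀ (by positivity)] at hq
  refine ⟨max (q / θ) (q / (3 / 8 * δ)), fun G _ _ A N hN hA hmany => ?_⟩
  obtain ⟨hqθ, hqδ⟩ := max_le_iff.1 hN
  have hNpos : 0 < N := hqθ.trans_lt' (by positivity)
  rw [div_le_iff₀' (by positivity)] at hqθ hqδ
  obtain ⟨𝒞, hcard, h𝒞⟩ := exists_isSumFreeCover_card_le hNpos hδ hA hmany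
    (by exact_mod_cast hqpos) hqθ hqδ (by nlinarith)
  have hD : (#(popularSummands A (δ / 2 * N)) : ℝ) ≤ N :=
    le_trans (by exact_mod_cast card_le_card popularSummands_subset) hA
  refine ⟨𝒞, ?_, h𝒞⟩
  calc (#𝒞 : ℝ) ≤ #(smallSubsets (popularSummands A (δ / 2 * N)) (θ * N)) *
          #(smallSubsets A (θ * N)) := by exact_mod_cast hcard
    _ ≤ 2 ^ (κ / 2 * N) * 2 ^ (κ / 2 * N) := by
        gcongr
        exacts [hfew _ _ hD, hfew _ _ hA]
    _ = 2 ^ (κ * N) := by rw [← Real.rpow_add two_pos]; ring_nf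

theorem exists_forall_sumFreeExcess_le {K ε : ℝ} (hK : 0 ≤ K) (hε : 0 < ε) :
    ∃ N₀ : ℝ, ∀ ⦃G : Type*⦄ [AddCommGroup G] [DecidableEq G] ⦃R : Finset G⦄, N₀ ≤ #R →
      (#(R + R) : ℝ) ≤ K * #R → sumFreeExcess R ≤ ε * #R := by
  obtain ⟨δ, hδ, hsupersaturation⟩ := exists_mul_card_sq_le_card_schurPairs hK (half_pos hε)
  obtain ⟨k, hk⟩ := exists_nat_gt (8 / δ)
  have hkpos : (0 : ℝ) < k := hk.trans' (by positivity)
  rw [div_lt_iff₀ hδ] at hk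
  obtain ⟨N₀, hcontainer⟩ := exists_forall_isSumFreeCover_card_le_two_rpow hδ
    (κ := ε / (2 * k)) (by positivity)
  refine ⟨N₀, fun G _ _ R hR hdoubling => ?_⟩
  have hsteps : (#R : ℝ) ≤ maxSumFree R + ε / 2 * #R + k * (δ / 8 * #R) := by
    have : 8 * (#R : ℝ) ≤ k * δ * #R := by gcongr
    have : 0 ≤ (maxSumFree R : ℝ) + ε / 2 * #R := by positivity
    linarith
  have hbound := numSumFree_le_two_rpow_of_isSumFreeCover (c := ε / (2 * k) * #R) (by positivity)
    (fun A hAR hA => hcontainer hR (by exact_mod_cast card_le_card hAR)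
      (hsupersaturation hAR hdoubling hA)) k (Subset.refl R) hsteps
  rw [sumFreeExcess_le_iff]
  convert hbound using 2
  field_simp
  ring

theorem mainTheorem2_general {ι : Type*} {l : Filter ι} {G : ι → Type*} [∀ i, AddCommGroup (G i)]
    [∀ i, DecidableEq (G i)] {R : ∀ i, Finset (G i)}
    (hcard : Tendsto (fun i => #(R i)) l atTop)
    (hdoubling : (fun i => (#(R i + R i) : ℝ)) =O[l] fun i => (#(R i) : ℝ)) :
    ∃ e : ι → ℝ, (e =o[l] fun i => (#(R i) : ℝ)) ∧
      ∀ i, (numSumFree (R i) : ℝ) = 2 ^ ((maxSumFree (R i) : ℝ) + e i) := by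
  refine ⟨fun i => sumFreeExcess (R i), isLittleO_iff.2 fun ε hε => ?_,
    fun i => numSumFree_eq_two_rpow_add_sumFreeExcess (R i)⟩
  obtain ⟨K, hK, hKdoubling⟩ := hdoubling.exists_nonneg
  obtain ⟨N₀, hN₀⟩ := exists_forall_sumFreeExcess_le hK hε
  filter_upwards [hKdoubling.bound, (tendsto_natCast_atTop_atTop.comp hcard).eventually_ge_atTop N₀]
    with i hi hlarge
  simp only [RCLike.norm_natCast, Real.norm_of_nonneg (sumFreeExcess_nonneg _)] at hi ⊢
  exact hN₀ hlarge hi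

section LatticeBox

variable {n d : ℕ}

theorem mem_latticeBox {x : Fin d → ℤ} : x ∈ latticeBox n d ↔ ∀ i, 1 ≤ x i ∧ x i ≤ n := by
  simp [latticeBox]

theorem card_latticeBox (n d : ℕ) : #(latticeBox n d) = n ^ d := by
  simp [latticeBox]

theorem latticeBox_add_latticeBox_subset :
    latticeBox n d + latticeBox n d ⊆ latticeBox (2 * n) d := by
  refine add_subset_iff.2 fun x hx y hy => mem_latticeBox.2 fun i => ?_
  have hxi := mem_latticeBox.1 hx i
  have hyi := mem_latticeBox.1 hy i
  rw [Pi.add_apply]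
  omega

theorem card_latticeBox_add_latticeBox_le (n d : ℕ) :
    #(latticeBox n d + latticeBox n d) ≤ 2 ^ d * #(latticeBox n d) :=
  (card_le_card latticeBox_add_latticeBox_subset).trans_eq (by simp only [card_latticeBox, mul_pow])

end LatticeBox

theorem mainTheorem2 (d : ℕ) :
    ∃ e : ℕ → ℝ,
      (e =o[atTop] fun n : ℕ => (n : ℝ) ^ d) ∧
      ∀ n : ℕ, (numSumFree (latticeBox n d) : ℝ) =
        (2 : ℝ) ^ ((maxSumFree (latticeBox n d) : ℝ) + e n) := by
  obtain rfl | hd := eq_or_ne d 0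
  · exact ⟨0, isLittleO_zero _ _, by simp [numSumFree, maxSumFree, sumFreeSubsets_of_subsingleton]⟩
  · have hcard : Tendsto (fun n => #(latticeBox n d)) atTop atTop := by
      simpa only [card_latticeBox] using tendsto_pow_atTop hd
    have hdoubling : (fun n => (#(latticeBox n d + latticeBox n d) : ℝ)) =O[atTop]
        fun n => (#(latticeBox n d) : ℝ) :=
      .of_bound (2 ^ d) (.of_forall fun n => by
        simpa using mod_cast card_latticeBox_add_latticeBox_le n d)
    simpa only [card_latticeBox, Nat.cast_pow] using mainTheorem2_general hcard hdoubling
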